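/- Let $H$ be a complex Hilbert space and let $A, B$ be bounded linear operators on $H$. For a bounded linear operator $T$ on $H$ write $T^*$ for its adjoint, $|T| = (T^*T)^{1/2}$ (so that $|T^*| = (TT^*)^{1/2}$), $\|T\|$ for its operator norm, and $w(T) = \sup\{|\langle Tx, x\rangle| : x \in H,\ \|x\| = 1\}$ for its numerical radius. Real powers $P^s$ ($s \ge 0$) of a positive operator $P$ are defined by the continuous functional calculus, with $P^0 = I$. Then $$ w(AB) \le \frac14 \, \bigl\| |A|^{2t} + |B^*|^{2t} \bigr\| \, \bigl\| |A^*|^{2(1-t)} + |B|^{2(1-t)} \bigr\| \qquad \text{for all } t \in [0,1]. $$ -/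

import Mathlib

/-- The numerical radius `w(T) = sup { |⟪T x, x⟫| : ‖x‖ = 1 }` of a bounded linear operator `T`
on a complex Hilbert space. (On the zero space there is no unit vector and the value is `0`.) -/
noncomputable def numericalRadius {H : Type*} [NormedAddCommGroup H] [InnerProductSpace ℂ H]
    (T : H →L[ℂ] H) : ℝ :=
  sSup {r : ℝ | ∃ x : H, ‖x‖ = 1 ∧ r = ‖inner ℂ (T x) x‖}

/-- The set in the definition of the numerical radius is bounded above by the operator norm, so
the supremum is a genuine one. -/
theorem numericalRadius_bddAbove {H : Type*} [NormedAddCommGroup H] [InnerProductSpace ℂ H]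
    (T : H →L[ℂ] H) : BddAbove {r : ℝ | ∃ x : H, ‖x‖ = 1 ∧ r = ‖inner ℂ (T x) x‖} := by
  refine ⟨‖T‖, ?_⟩
  rintro r ⟨x, hx, rfl⟩
  have h1 := norm_inner_le_norm (𝕜 := ℂ) (T x) x
  have h2 := T.le_opNorm x
  rw [hx, mul_one] at h1 h2
  exact h1.trans h2

open Filter Topology

section IntertwiningCalculus

variable {𝒜 : Type*} [CStarAlgebra 𝒜]

/-! By polar decomposition, A = |A*|^(1-t) V |A|^t and B = |B*|^t W |B|^(1-t) with contractions V,
W, so |⟨ABx, x⟩| ≤ ‖|A|^t |B*|^t‖ ‖|B|^(1-t) x‖ ‖|A*|^(1-t) x‖. The AM-GM inequality for the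
operator norm bounds the first factor, the scalar one the other two; each yields a factor 1/2. The
partial isometries are replaced by contractions that give the factorizations in the limit. -/

theorem aeval_mul_eq_mul_aeval_of_intertwine {R S : Type*} [CommSemiring R] [Semiring S]
    [Algebra R S] {a b c : S} (h : a * b = b * c) (p : Polynomial R) :
    Polynomial.aeval a p * b = b * Polynomial.aeval c p := by
  have h' : SemiconjBy b c a := h.symm
  induction p using Polynomial.induction_on' with
  | add p q hp hq => simp only [map_add, add_mul, mul_add, hp, hq]
  | monomial n r =>
    have hn := (h'.pow_right n).eq
    rw [Polynomial.aeval_monomial, Polynomial.aeval_monomial, mul_assoc, ← hn, ← mul_assoc,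
      Algebra.commutes r b, mul_assoc]

/-- The continuous functional calculus respects intertwining relations between self-adjoint
elements. -/
theorem cfc_mul_eq_mul_cfc_of_intertwine {a b c : 𝒜} (ha : IsSelfAdjoint a)
    (hc : IsSelfAdjoint c) (h : a * b = b * c) {f : ℝ → ℝ} (hf : Continuous f) :
    cfc f a * b = b * cfc f c := by
  -- One interval contains both spectra, so a single polynomial approximates `f` for `a` and `c` at
  -- once.
  obtain ⟨M, hM⟩ : ∃ M : ℝ, ∀ x ∈ spectrum ℝ a ∪ spectrum ℝ c, x ∈ Set.Icc (-M) M := by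
    obtain ⟨M, hM⟩ := ((spectrum.isCompact (𝕜 := ℝ) a).union
      (spectrum.isCompact (𝕜 := ℝ) c)).isBounded.exists_norm_le
    exact ⟨M, fun x hx => abs_le.1 (hM x hx)⟩
  have key : ∀ ε : ℝ, 0 < ε → ‖cfc f a * b - b * cfc f c‖ ≤ ε * (2 * ‖b‖) := by
    intro ε hε
    obtain ⟨p, hp⟩ := exists_polynomial_near_of_continuousOn (-M) M f hf.continuousOn ε hε
    have near : ∀ d : 𝒜, IsSelfAdjoint d → (∀ x ∈ spectrum ℝ d, x ∈ Set.Icc (-M) M) →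
        ‖cfc f d - Polynomial.aeval d p‖ ≤ ε := by
      intro d hd hdM
      rw [← cfc_polynomial p d, ← cfc_sub f p.eval d hf.continuousOn p.continuous.continuousOn]
      refine norm_cfc_le hε.le fun x hx => ?_
      rw [norm_sub_rev]
      exact (hp x (hdM x hx)).le
    have e : cfc f a * b - b * cfc f c
        = (cfc f a - Polynomial.aeval a p) * b - b * (cfc f c - Polynomial.aeval c p) := by
      rw [sub_mul, mul_sub, aeval_mul_eq_mul_aeval_of_intertwine h p]
      abel
    rw [e]
    have h1 := near a ha fun x hx => hM x (Or.inl hx)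
    have h2 := near c hc fun x hx => hM x (Or.inr hx)
    calc _ ≤ ‖cfc f a - Polynomial.aeval a p‖ * ‖b‖ + ‖b‖ * ‖cfc f c - Polynomial.aeval c p‖ :=
          (norm_sub_le _ _).trans (add_le_add (norm_mul_le _ _) (norm_mul_le _ _))
      _ ≤ ε * ‖b‖ + ‖b‖ * ε := by gcongr
      _ = ε * (2 * ‖b‖) := by ring
  refine sub_eq_zero.1 (norm_le_zero_iff.1 (le_of_forall_pos_le_add fun δ hδ => ?_))
  refine (key (δ / (2 * ‖b‖ + 1)) (by positivity)).trans ?_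
  rw [zero_add, div_mul_eq_mul_div, div_le_iff₀ (by positivity)]
  nlinarith [norm_nonneg b]

/-- The C*-identity turns the squared norm into that of s f(s)² evaluated at b*b. -/
theorem norm_mul_cfc_star_mul_self_sq_le (b : 𝒜) {f : ℝ → ℝ} (hf : Continuous f) {C : ℝ}
    (hC : 0 ≤ C) (h : ∀ s, 0 ≤ s → s * f s ^ 2 ≤ C) : ‖b * cfc f (star b * b)‖ ^ 2 ≤ C := by
  let _ := CStarAlgebra.spectralOrder 𝒜
  let _ := CStarAlgebra.spectralOrderedRing 𝒜
  have hs : star (cfc f (star b * b)) = cfc f (star b * b) := (cfc_predicate f (star b * b)).star_eq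
  have e : star (b * cfc f (star b * b)) * (b * cfc f (star b * b))
      = cfc (fun s => f s * s * f s) (star b * b) := by
    rw [cfc_mul (fun s => f s * s) f _ (by fun_prop) (by fun_prop),
      cfc_mul f (fun s => s) _ (by fun_prop) (by fun_prop), cfc_id' ℝ (star b * b), star_mul, hs]
    simp only [mul_assoc]
  rw [sq, ← CStarRing.norm_star_mul_self, e]
  refine norm_cfc_le hC fun s hs' => ?_
  have h0 : 0 ≤ s := spectrum_nonneg_of_nonneg (star_mul_self_nonneg b) hs'
  rw [show f s * s * f s = s * f s ^ 2 by ring, Real.norm_of_nonneg (by positivity)]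
  exact h s h0

end IntertwiningCalculus

section Modulus

variable {𝒜 : Type*} [CStarAlgebra 𝒜] [PartialOrder 𝒜] [StarOrderedRing 𝒜]

theorem abs_rpow_eq_cfc (a : 𝒜) {r : ℝ} (hr : 0 ≤ r) :
    CFC.abs a ^ r = cfc (fun s : ℝ => s ^ (r / 2)) (star a * a) := by
  rw [CFC.abs, CFC.sqrt_eq_rpow, CFC.rpow_rpow_of_exponent_nonneg _ _ _ (by norm_num) hr,
    CFC.rpow_eq_cfc_real, one_div, inv_mul_eq_div]

theorem abs_rpow_two_mul (a : 𝒜) {r : ℝ} (hr : 0 ≤ r) :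
    CFC.abs a ^ (2 * r) = CFC.abs a ^ r * CFC.abs a ^ r := by
  have hc : Continuous fun s : ℝ => s ^ (r / 2) := Real.continuous_rpow_const (by positivity)
  rw [abs_rpow_eq_cfc a hr, abs_rpow_eq_cfc a (by positivity), ← cfc_mul _ _ _
    hc.continuousOn hc.continuousOn]
  refine cfc_congr fun s hs => ?_
  have h0 : 0 ≤ s := spectrum_nonneg_of_nonneg (star_mul_self_nonneg a) hs
  rw [← Real.rpow_add_of_nonneg h0 (by positivity) (by positivity)]
  congr 1
  ring

/-- An approximate form of the factorization `b = |b⋆| ^ t * u * |b| ^ (1 - t)`, where `u` is the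
partial isometry of the polar decomposition of `b`. -/
theorem exists_contraction_norm_sub_abs_rpow_mul_le (b : 𝒜) {t : ℝ} (ht : t ∈ Set.Icc (0 : ℝ) 1)
    {ε : ℝ} (hε : 0 < ε) : ∃ w : 𝒜, ‖w‖ ≤ 1 ∧
      ‖b - CFC.abs (star b) ^ t * w * CFC.abs b ^ (1 - t)‖ ≤ ε := by
  obtain ⟨ht0, ht1⟩ := ht
  have ht1' : 0 ≤ 1 - t := sub_nonneg.2 ht1
  -- A regularized s^(-1/2): b (b*b + ε²)^(-1/2) stands in for the partial isometry. The absolute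
  -- value makes `g` continuous on all of ℝ.
  set g : ℝ → ℝ := fun s => (√(|s| + ε ^ 2))⁻¹ with hg
  have hpos : ∀ s : ℝ, 0 < √(|s| + ε ^ 2) := fun s => Real.sqrt_pos.2 (by positivity)
  have hgc : Continuous g :=
    Continuous.inv₀ (by fun_prop) fun s => (hpos s).ne'
  have hc1 : Continuous fun s : ℝ => s ^ (t / 2) := Real.continuous_rpow_const (by positivity)
  have hc2 : Continuous fun s : ℝ => s ^ ((1 - t) / 2) :=
    Real.continuous_rpow_const (by positivity)
  have hgsq : ∀ s, 0 ≤ s → g s ^ 2 = (s + ε ^ 2)⁻¹ := fun s hs => by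
    rw [hg, inv_pow, Real.sq_sqrt (by positivity), abs_of_nonneg hs]
  refine ⟨b * cfc g (star b * b), ?_, ?_⟩
  · refine (sq_le_one_iff₀ (norm_nonneg _)).1 ?_
    refine norm_mul_cfc_star_mul_self_sq_le b hgc zero_le_one fun s hs => ?_
    rw [hgsq s hs, ← div_eq_mul_inv, div_le_one (by positivity)]
    nlinarith
  · set h : ℝ → ℝ := fun s => s ^ (t / 2) * g s * s ^ ((1 - t) / 2) with hh
    have hhc : Continuous h := (hc1.mul hgc).mul hc2
    -- Since (bb*)b = b(b*b), the power of |b*| moves across b and the error becomes a function of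
    -- b*b alone.
    have e : b - CFC.abs (star b) ^ t * (b * cfc g (star b * b)) * CFC.abs b ^ (1 - t)
        = b * cfc (fun s => 1 - h s) (star b * b) := by
      rw [cfc_sub (fun _ => 1) h _ (by fun_prop) hhc.continuousOn, cfc_const_one ℝ (star b * b),
        hh, cfc_mul (fun s => s ^ (t / 2) * g s) _ _ (hc1.mul hgc).continuousOn hc2.continuousOn,
        cfc_mul (fun s => s ^ (t / 2)) g _ hc1.continuousOn hgc.continuousOn,
        abs_rpow_eq_cfc _ ht0, abs_rpow_eq_cfc _ ht1', star_star, ← mul_assoc (cfc _ (b * star b)),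
        cfc_mul_eq_mul_cfc_of_intertwine (.mul_star_self b) (.star_mul_self b)
          (mul_assoc b (star b) b) hc1]
      simp only [mul_sub, mul_one, mul_assoc]
    rw [e]
    refine (sq_le_sq₀ (norm_nonneg _) hε.le).1 ?_
    refine norm_mul_cfc_star_mul_self_sq_le b (continuous_const.sub hhc) (sq_nonneg ε)
      fun s hs => ?_
    have hhs : h s = √s * g s := by
      have : s ^ (t / 2) * s ^ ((1 - t) / 2) = √s := by
        rw [← Real.rpow_add_of_nonneg hs (by positivity) (by positivity), Real.sqrt_eq_rpow]
        congr 1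
        ring
      rw [hh, ← this]
      ring
    have hle : √s ≤ √(|s| + ε ^ 2) := Real.sqrt_le_sqrt ((le_abs_self s).trans (by nlinarith))
    have hsq : √(|s| + ε ^ 2) ≤ √s + ε := by
      rw [Real.sqrt_le_left (by positivity), abs_of_nonneg hs]
      nlinarith [Real.sq_sqrt hs, Real.sqrt_nonneg s]
    have h1 : √s * (1 - h s) ≤ ε := by
      rw [hhs, hg]
      have hp := hpos s
      have : √s * (1 - √s * (√(|s| + ε ^ 2))⁻¹)
          = √s / √(|s| + ε ^ 2) * (√(|s| + ε ^ 2) - √s) := by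
        field_simp
      rw [this]
      calc _ ≤ 1 * (√(|s| + ε ^ 2) - √s) := by
            refine mul_le_mul_of_nonneg_right ((div_le_one hp).2 hle) (by linarith)
        _ ≤ ε := by linarith
    have h0 : 0 ≤ √s * (1 - h s) := by
      refine mul_nonneg (Real.sqrt_nonneg s) (sub_nonneg.2 ?_)
      rw [hhs, hg, ← div_eq_mul_inv]
      exact (div_le_one (hpos s)).2 hle
    calc s * (1 - h s) ^ 2 = (√s * (1 - h s)) ^ 2 := by rw [mul_pow, Real.sq_sqrt hs]
      _ ≤ ε ^ 2 := by gcongr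

theorem exists_contraction_seq_tendsto (b : 𝒜) {t : ℝ} (ht : t ∈ Set.Icc (0 : ℝ) 1) :
    ∃ w : ℕ → 𝒜, (∀ n, ‖w n‖ ≤ 1) ∧
      Tendsto (fun n => CFC.abs (star b) ^ t * w n * CFC.abs b ^ (1 - t)) atTop (𝓝 b) := by
  choose w hw hwb using fun n : ℕ =>
    exists_contraction_norm_sub_abs_rpow_mul_le b ht (Nat.one_div_pos_of_nat (α := ℝ) (n := n))
  refine ⟨w, hw, tendsto_iff_norm_sub_tendsto_zero.2 ?_⟩
  refine squeeze_zero (fun _ => norm_nonneg _) (fun n => ?_) tendsto_one_div_add_atTop_nhds_zero_nat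
  rw [norm_sub_rev]
  exact hwb n

end Modulus

section Operator

variable {H : Type*} [NormedAddCommGroup H] [InnerProductSpace ℂ H] [CompleteSpace H]

theorem norm_sq_add_norm_sq_eq_re_inner {P Q : H →L[ℂ] H} (hP : IsSelfAdjoint P)
    (hQ : IsSelfAdjoint Q) (z : H) :
    ‖P z‖ ^ 2 + ‖Q z‖ ^ 2 = (inner ℂ ((P * P + Q * Q) z) z).re := by
  have hP' := hP.isSymmetric (P z) z
  have hQ' := hQ.isSymmetric (Q z) z
  simp only [ContinuousLinearMap.coe_coe] at hP' hQ'
  rw [add_apply, inner_add_left, show (P * P) z = P (P z) from rfl,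
    show (Q * Q) z = Q (Q z) from rfl, hP', hQ', inner_self_eq_norm_sq_to_K,
    inner_self_eq_norm_sq_to_K]
  norm_cast

theorem norm_sq_add_norm_sq_le {P Q : H →L[ℂ] H} (hP : IsSelfAdjoint P)
    (hQ : IsSelfAdjoint Q) (z : H) :
    ‖P z‖ ^ 2 + ‖Q z‖ ^ 2 ≤ ‖P * P + Q * Q‖ * ‖z‖ ^ 2 := by
  rw [norm_sq_add_norm_sq_eq_re_inner hP hQ]
  calc _ ≤ ‖inner ℂ ((P * P + Q * Q) z) z‖ := Complex.re_le_norm _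
    _ ≤ ‖(P * P + Q * Q) z‖ * ‖z‖ := norm_inner_le_norm _ _
    _ ≤ ‖P * P + Q * Q‖ * ‖z‖ * ‖z‖ := by gcongr; exact ContinuousLinearMap.le_opNorm _ _
    _ = _ := by ring

/-- The row (P, Q) is the adjoint of the column z ↦ (Pz, Qz), so both have squared norm at most ‖P²
+ Q²‖. -/
theorem norm_add_apply_sq_le {P Q : H →L[ℂ] H} (hP : IsSelfAdjoint P) (hQ : IsSelfAdjoint Q)
    (x y : H) : ‖P x + Q y‖ ^ 2 ≤ ‖P * P + Q * Q‖ * (‖x‖ ^ 2 + ‖y‖ ^ 2) := by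
  set z := P x + Q y with hz
  have hP' := hP.isSymmetric x z
  have hQ' := hQ.isSymmetric y z
  simp only [ContinuousLinearMap.coe_coe] at hP' hQ'
  have e : ‖z‖ ^ 2 = ‖inner ℂ x (P z) + inner ℂ y (Q z)‖ := by
    rw [← hP', ← hQ', ← inner_add_left, ← hz, inner_self_eq_norm_sq_to_K]
    simp
  have h1 : ‖z‖ ^ 2 ≤ ‖x‖ * ‖P z‖ + ‖y‖ * ‖Q z‖ := by
    rw [e]
    exact (norm_add_le _ _).trans (add_le_add (norm_inner_le_norm _ _) (norm_inner_le_norm _ _))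
  have h2 := norm_sq_add_norm_sq_le hP hQ z
  rcases eq_or_ne (‖z‖ ^ 2) 0 with h0 | h0
  · rw [h0]; positivity
  · have hzpos : 0 < ‖z‖ ^ 2 := lt_of_le_of_ne (by positivity) h0.symm
    refine le_of_mul_le_mul_right ?_ hzpos
    calc ‖z‖ ^ 2 * ‖z‖ ^ 2 ≤ (‖x‖ * ‖P z‖ + ‖y‖ * ‖Q z‖) * (‖x‖ * ‖P z‖ + ‖y‖ * ‖Q z‖) := by
          gcongr
      _ ≤ (‖x‖ ^ 2 + ‖y‖ ^ 2) * (‖P z‖ ^ 2 + ‖Q z‖ ^ 2) := by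
          nlinarith [sq_nonneg (‖x‖ * ‖Q z‖ - ‖y‖ * ‖P z‖)]
      _ ≤ (‖x‖ ^ 2 + ‖y‖ ^ 2) * (‖P * P + Q * Q‖ * ‖z‖ ^ 2) := by gcongr
      _ = _ := by ring

/-- The arithmetic-geometric mean inequality for the operator norm. -/
theorem norm_mul_le_half_norm_mul_self_add {P Q : H →L[ℂ] H} (hP : IsSelfAdjoint P)
    (hQ : IsSelfAdjoint Q) : ‖P * Q‖ ≤ 1 / 2 * ‖P * P + Q * Q‖ := by
  refine ContinuousLinearMap.opNorm_le_bound _ (by positivity) fun y => ?_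
  set z := (P * Q) y with hz
  have key : ∀ u v : H, 4 * (inner ℂ (P u) (Q v)).re ≤
      ‖P * P + Q * Q‖ * (‖u‖ ^ 2 + ‖v‖ ^ 2) := by
    intro u v
    have h1 := norm_add_apply_sq_le hP hQ u v
    have h2 := norm_add_sq (𝕜 := ℂ) (P u) (Q v)
    have h3 := norm_sub_sq (𝕜 := ℂ) (P u) (Q v)
    simp only [RCLike.re_to_complex] at h2 h3
    nlinarith [sq_nonneg ‖P u - Q v‖]
  have hzz : inner ℂ (P z) (Q y) = ((‖z‖ ^ 2 : ℝ) : ℂ) := by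
    have h : inner ℂ (P z) (Q y) = inner ℂ z (P (Q y)) := hP.isSymmetric z (Q y)
    rw [h, show P (Q y) = z from rfl, inner_self_eq_norm_sq_to_K]
    norm_cast
  -- Rescaling gives both vectors the norm ‖y‖‖z‖, so the sum of squares in `key` loses nothing.
  have h := key ((‖y‖ : ℂ) • z) ((‖z‖ : ℂ) • y)
  rw [map_smul, map_smul, inner_smul_left, inner_smul_right, hzz, Complex.conj_ofReal,
    ← Complex.ofReal_mul, ← Complex.ofReal_mul, Complex.ofReal_re, norm_smul, norm_smul,
    Complex.norm_real, Complex.norm_real, norm_norm, norm_norm] at h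
  rcases (norm_nonneg z).eq_or_lt with h0 | h0
  · rw [← h0]; positivity
  rcases (norm_nonneg y).eq_or_lt with h1 | h1
  · rw [hz, norm_eq_zero.1 h1.symm]; simp
  refine le_of_mul_le_mul_right ?_ (show 0 < 4 * (‖y‖ * ‖z‖ ^ 2) by positivity)
  linarith

end Operator

theorem norm_inner_mul_apply_le {H : Type*} [NormedAddCommGroup H] [InnerProductSpace ℂ H]
    [CompleteSpace H] (A B : H →L[ℂ] H) {t : ℝ} (ht : t ∈ Set.Icc (0 : ℝ) 1) (x : H) :
    ‖inner ℂ ((A * B) x) x‖ ≤ ‖CFC.abs A ^ t * CFC.abs (star B) ^ t‖ *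
      (‖(CFC.abs (star A) ^ (1 - t)) x‖ * ‖(CFC.abs B ^ (1 - t)) x‖) := by
  -- Factoring A* and taking adjoints puts |A|^t on the right of A, next to |B*|^t.
  obtain ⟨v, hv, hvA⟩ := exists_contraction_seq_tendsto (star A) ht
  obtain ⟨w, hw, hwB⟩ := exists_contraction_seq_tendsto B ht
  rw [star_star] at hvA
  set P := CFC.abs A ^ t
  set P' := CFC.abs (star A) ^ (1 - t)
  set Q := CFC.abs (star B) ^ t
  set Q' := CFC.abs B ^ (1 - t)
  have hP : IsSelfAdjoint P := CFC.rpow_nonneg.isSelfAdjoint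
  have hP' : IsSelfAdjoint P' := CFC.rpow_nonneg.isSelfAdjoint
  have hA : Tendsto (fun n => P' * star (v n) * P) atTop (𝓝 A) := by
    have := hvA.star
    simpa only [star_star, star_mul, hP.star_eq, hP'.star_eq, ← mul_assoc] using this
  have hlim : Tendsto (fun n => ‖inner ℂ ((P' * star (v n) * P * (Q * w n * Q')) x) x‖) atTop
      (𝓝 ‖inner ℂ ((A * B) x) x‖) :=
    ((((ContinuousLinearMap.apply ℂ H x).continuous.tendsto _).comp (hA.mul hwB)).inner
      tendsto_const_nhds).norm
  refine le_of_tendsto' hlim fun n => ?_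
  have e : inner ℂ ((P' * star (v n) * P * (Q * w n * Q')) x) x
      = inner ℂ ((star (v n) * ((P * Q) * w n)) (Q' x)) (P' x) :=
    hP'.isSymmetric ((star (v n) * ((P * Q) * w n)) (Q' x)) x
  have hn : ‖star (v n) * ((P * Q) * w n)‖ ≤ ‖P * Q‖ :=
    calc _ ≤ ‖star (v n)‖ * (‖P * Q‖ * ‖w n‖) :=
          (norm_mul_le _ _).trans (by gcongr; exact norm_mul_le _ _)
      _ ≤ 1 * (‖P * Q‖ * 1) := by
          gcongr
          · rw [norm_star]; exact hv n
          · exact hw n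
      _ = ‖P * Q‖ := by ring
  rw [e]
  calc _ ≤ ‖(star (v n) * ((P * Q) * w n)) (Q' x)‖ * ‖P' x‖ := norm_inner_le_norm _ _
    _ ≤ ‖P * Q‖ * ‖Q' x‖ * ‖P' x‖ := by
        gcongr
        exact ContinuousLinearMap.le_of_opNorm_le _ hn _
    _ = _ := by ring

/-- `CFC.abs T = (T⋆ T)^{1/2}` is the modulus `|T|`, `star` is the Hilbert adjoint, and the real
powers of a positive operator are those of the continuous functional calculus (so `P ^ 0 = 1`). -/
theorem corollary2p17 {H : Type*} [NormedAddCommGroup H] [InnerProductSpace ℂ H] [CompleteSpace H]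
    (A B : H →L[ℂ] H) (t : ℝ) (ht : t ∈ Set.Icc (0 : ℝ) 1) :
    numericalRadius (A * B) ≤
      (1 / 4 : ℝ) * ‖CFC.abs A ^ (2 * t) + CFC.abs (star B) ^ (2 * t)‖
        * ‖CFC.abs (star A) ^ (2 * (1 - t)) + CFC.abs B ^ (2 * (1 - t))‖ := by
  have ht1 : 0 ≤ 1 - t := sub_nonneg.2 ht.2
  have hsa : ∀ (T : H →L[ℂ] H) (r : ℝ), IsSelfAdjoint (CFC.abs T ^ r) := fun T r =>
    CFC.rpow_nonneg.isSelfAdjoint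
  simp only [abs_rpow_two_mul _ ht.1, abs_rpow_two_mul _ ht1]
  -- Nonnegativity of the bound covers the zero space, where the supremum is over the empty set.
  refine Real.sSup_le ?_ (by positivity)
  rintro r ⟨x, hx, rfl⟩
  have h1 := norm_mul_le_half_norm_mul_self_add (hsa A t) (hsa (star B) t)
  have h2 := norm_sq_add_norm_sq_le (hsa (star A) (1 - t)) (hsa B (1 - t)) x
  rw [hx, one_pow, mul_one] at h2
  refine (norm_inner_mul_apply_le A B ht x).trans ?_
  have h3 : ‖(CFC.abs (star A) ^ (1 - t)) x‖ * ‖(CFC.abs B ^ (1 - t)) x‖ ≤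
      1 / 2 * ‖CFC.abs (star A) ^ (1 - t) * CFC.abs (star A) ^ (1 - t) +
        CFC.abs B ^ (1 - t) * CFC.abs B ^ (1 - t)‖ := by
    linarith [two_mul_le_add_sq ‖(CFC.abs (star A) ^ (1 - t)) x‖ ‖(CFC.abs B ^ (1 - t)) x‖]
  refine (mul_le_mul h1 h3 (by positivity) (by positivity)).trans_eq ?_
  ring
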